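/- Let $n\ge 0$, let $M$ be a nonempty Hausdorff, second countable smooth manifold with a continuous action of the torus $\mathbb T^n$, and let $N$ be a Hausdorff smooth manifold with a continuous action $\beta$ of $\mathbb R^n$ by diffeomorphisms. Suppose that the quotient space $\Delta=M/\mathbb T^n$ is (homeomorphically identified with) a locally closed subset of $N$. For $y\in\Delta$ let $\mathbb T^n_y$ be the common isotropy group of the points of the orbit $y$; for $k\in\mathbb Z^n$ let $\Delta(k)=\{y\in\Delta : s_1^{k_1}\cdots s_n^{k_n}=1\ \text{for all } s\in\mathbb T^n_y\}$. Let $\widetilde G=(\mathbb R\times N)\rtimes\mathbb Z^n$ be the crossed product groupoid of the right action $(\hbar,y)\cdot k=(\hbar,\beta_{\hbar k}(y))$; its arrows are the triples $(\hbar,y,k)$, with source $s(\hbar,y,k)=(\hbar,y)$, range $r(\hbar,y,k)=(\hbar,\beta_{\hbar k}(y))$ and product $(\hbar,\beta_{\hbar k}(y),l)(\hbar,y,k)=(\hbar,y,k+l)$. Put $$G=\{(\hbar,y,k)\in\mathbb R\times N\times\mathbb Z^n : y,\beta_{\hbar k}(y)\in\Delta(k)\ \text{and}\ \mathbb T^n_y=\mathbb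 T^n_{\beta_{\hbar k}(y)}\},$$ with the topology induced by $\mathbb R\times N\times\mathbb Z^n$, and $G_k=G\cap(\mathbb R\times N\times\{k\})$. Call a topological groupoid étale if it is locally compact, Hausdorff and second countable, the fibres of its range map are discrete, and the counting measures on these fibres form a continuous Haar system. Then: 1. $G$ is a subgroupoid of $\widetilde G$, with unit space $G^{(0)}=\mathbb R\times\Delta$. 2. $G$ is étale if and only if, for every $k\in\mathbb Z^n$, the set $$s(G_k)=\{(\hbar,y) : y,\beta_{\hbar k}(y)\in\Delta(k)\ \text{and}\ \mathbb T^n_y=\mathbb T^n_{\beta_{\hbar k}(y)}\}$$ is open in $\mathbb R\times\Delta$. 3. In that case $G$ is a locally compact, Hausdorff, second countable bundle of groupoids over $\mathbb R$ (with bundle projection $(\hbar,y,k)\mapsto\hbar$), it is topologically amenable (it has a topological approximate invariant mean), it has a continuous Haar system, and the projection $G\to\mathbb R$ is open and surjective. -/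

import Mathlib

open Set MeasureTheory Topology
open scoped Manifold ContDiff

/-! ### Groupoids, presented by their space of arrows `G` and their space of units `X` -/

/-- A groupoid with set of arrows `G` and set of units `X`; `mul g h` is the composite `g h`,
defined when the source of `g` is the range of `h`. -/
structure ArrowGroupoid (G : Type*) (X : Type*) where
  source : G → X
  range : G → X
  unit : X → G
  inv : G → G
  mul : (g h : G) → source g = range h → G
  source_unit : ∀ x, source (unit x) = x
  range_unit : ∀ x, range (unit x) = x
  source_inv : ∀ g, source (inv g) = range g
  range_inv : ∀ g, range (inv g) = source g
  source_mul : ∀ g h (e : source g = range h), source (mul g h e) = source h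
  range_mul : ∀ g h (e : source g = range h), range (mul g h e) = range g
  mul_assoc : ∀ g h k (e : source g = range h) (e' : source h = range k),
    mul (mul g h e) k ((source_mul g h e).trans e') =
      mul g (mul h k e') (e.trans (range_mul h k e').symm)
  unit_mul : ∀ g, mul (unit (range g)) g (source_unit (range g)) = g
  mul_unit : ∀ g, mul g (unit (source g)) (range_unit (source g)).symm = g
  inv_mul : ∀ g, mul (inv g) g (source_inv g) = unit (source g)
  mul_inv : ∀ g, mul g (inv g) (range_inv g).symm = unit (range g)

namespace ArrowGroupoid

variable {G X : Type*}

/-- A subgroupoid: a set of arrows closed under products and inverses. -/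
structure Sub (𝒢 : ArrowGroupoid G X) where
  carrier : Set G
  mul_mem : ∀ g h (e : 𝒢.source g = 𝒢.range h),
    g ∈ carrier → h ∈ carrier → 𝒢.mul g h e ∈ carrier
  inv_mem : ∀ g, g ∈ carrier → 𝒢.inv g ∈ carrier

/-- The unit space of a subgroupoid, as a subset of the unit space of the ambient groupoid. -/
def Sub.units {𝒢 : ArrowGroupoid G X} (H : 𝒢.Sub) : Set X := {x | 𝒢.unit x ∈ H.carrier}

theorem Sub.source_mem {𝒢 : ArrowGroupoid G X} (H : 𝒢.Sub) {g : G} (hg : g ∈ H.carrier) :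
    𝒢.source g ∈ H.units := by
  have h := H.mul_mem (𝒢.inv g) g (𝒢.source_inv g) (H.inv_mem g hg) hg
  rw [𝒢.inv_mul] at h
  exact h

theorem Sub.range_mem {𝒢 : ArrowGroupoid G X} (H : 𝒢.Sub) {g : G} (hg : g ∈ H.carrier) :
    𝒢.range g ∈ H.units := by
  have h := H.mul_mem g (𝒢.inv g) (𝒢.range_inv g).symm hg (H.inv_mem g hg)
  rw [𝒢.mul_inv] at h
  exact h

/-- A subgroupoid as a groupoid in its own right, over its own unit space. -/
def Sub.toGroupoid {𝒢 : ArrowGroupoid G X} (H : 𝒢.Sub) :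
    ArrowGroupoid H.carrier H.units where
  source g := ⟨𝒢.source g, H.source_mem g.2⟩
  range g := ⟨𝒢.range g, H.range_mem g.2⟩
  unit x := ⟨𝒢.unit x, x.2⟩
  inv g := ⟨𝒢.inv g, H.inv_mem g g.2⟩
  mul g h e := ⟨𝒢.mul g h (congrArg Subtype.val e), H.mul_mem _ _ _ g.2 h.2⟩
  source_unit _ := Subtype.ext (𝒢.source_unit _)
  range_unit _ := Subtype.ext (𝒢.range_unit _)
  source_inv _ := Subtype.ext (𝒢.source_inv _)
  range_inv _ := Subtype.ext (𝒢.range_inv _)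
  source_mul _ _ _ := Subtype.ext (𝒢.source_mul _ _ _)
  range_mul _ _ _ := Subtype.ext (𝒢.range_mul _ _ _)
  mul_assoc _ _ _ _ _ := Subtype.ext (𝒢.mul_assoc _ _ _ _ _)
  unit_mul _ := Subtype.ext (𝒢.unit_mul _)
  mul_unit _ := Subtype.ext (𝒢.mul_unit _)
  inv_mul _ := Subtype.ext (𝒢.inv_mul _)
  mul_inv _ := Subtype.ext (𝒢.mul_inv _)

/-- The range fibre `G^x = {g | r(g) = x}`. -/
def Fiber (𝒢 : ArrowGroupoid G X) (x : X) : Type _ := {g : G // 𝒢.range g = x}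

/-- The underlying arrow of an element of `G^x`. -/
def Fiber.val {𝒢 : ArrowGroupoid G X} {x : X} (g : 𝒢.Fiber x) : G := Subtype.val g

/-- Left translation `h ↦ g h`, from `G^{s(g)}` to `G^{r(g)}`. -/
def translate (𝒢 : ArrowGroupoid G X) (g : G) (h : 𝒢.Fiber (𝒢.source g)) :
    𝒢.Fiber (𝒢.range g) :=
  ⟨𝒢.mul g h.val (Subtype.property h).symm, 𝒢.range_mul _ _ _⟩

variable [TopologicalSpace G]

/-- `G^x` carries the subspace topology ... -/
instance (𝒢 : ArrowGroupoid G X) (x : X) : TopologicalSpace (𝒢.Fiber x) :=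
  TopologicalSpace.induced Fiber.val inferInstance

/-- ... and its Borel sigma-algebra. -/
instance (𝒢 : ArrowGroupoid G X) (x : X) : MeasurableSpace (𝒢.Fiber x) := borel _

instance (𝒢 : ArrowGroupoid G X) (x : X) : BorelSpace (𝒢.Fiber x) := ⟨rfl⟩

variable [TopologicalSpace X]

/-- All structure maps are continuous. (As `source ∘ unit = id`, the unit space then carries
the topology induced by that of the arrows.) -/
structure IsTopological (𝒢 : ArrowGroupoid G X) : Prop where
  continuous_source : Continuous 𝒢.source
  continuous_range : Continuous 𝒢.range
  continuous_unit : Continuous 𝒢.unit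
  continuous_inv : Continuous 𝒢.inv
  continuous_mul : Continuous fun p : {p : G × G // 𝒢.source p.1 = 𝒢.range p.2} =>
    𝒢.mul p.1.1 p.1.2 p.2

/-- A topological groupoid whose space of arrows is locally compact, Hausdorff and separable
(that is, second countable). -/
structure IsLocallyCompactHausdorffSeparable (𝒢 : ArrowGroupoid G X) : Prop where
  isTopological : 𝒢.IsTopological
  locallyCompact : LocallyCompactSpace G
  hausdorff : T2Space G
  separable : SecondCountableTopology G

/-- A continuous system of Radon measures `m x` on the fibres `G^x`: for every continuous,
compactly supported `f` on `G`, the function `x ↦ ∫ f dm x` is continuous. -/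
structure IsContinuousSystem (𝒢 : ArrowGroupoid G X) (m : ∀ x, Measure (𝒢.Fiber x)) :
    Prop where
  regular : ∀ x, (m x).Regular
  continuous_integral : ∀ f : G → ℂ, Continuous f → HasCompactSupport f →
    Continuous fun x => ∫ g, f (Fiber.val g) ∂(m x)

/-- A continuous (left) Haar system: a continuous system of Radon measures on the fibres `G^x`,
of full support and invariant under left translation. -/
structure IsContinuousHaarSystem (𝒢 : ArrowGroupoid G X) (m : ∀ x, Measure (𝒢.Fiber x)) :
    Prop extends 𝒢.IsContinuousSystem m where
  fullSupport : ∀ x, (m x).IsOpenPosMeasure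
  invariant : ∀ g, (m (𝒢.source g)).map (𝒢.translate g) = m (𝒢.range g)

/-- A locally compact, Hausdorff, separable groupoid is étale when the fibres of the range map are
discrete and the counting measures form a continuous Haar system. -/
structure IsEtale (𝒢 : ArrowGroupoid G X) : Prop extends
    𝒢.IsLocallyCompactHausdorffSeparable where
  discrete : ∀ x, DiscreteTopology (𝒢.Fiber x)
  haar_count : 𝒢.IsContinuousHaarSystem fun _ => Measure.count

/-- (Topological) amenability: there is a topological approximate invariant mean, i.e. there
are continuous systems `m` of probability measures on the fibres `G^x` such that the total
variation norm of `g · m (s(g)) - m (r(g))` is arbitrarily small, uniformly for `g` in any given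
compact set of arrows. (Indexing by the pairs `(K, ε)` turns this into a net.) -/
def IsAmenable (𝒢 : ArrowGroupoid G X) : Prop :=
  ∀ K : Set G, IsCompact K → ∀ ε : ℝ, 0 < ε →
    ∃ (m : ∀ x, Measure (𝒢.Fiber x)) (_ : ∀ x, IsProbabilityMeasure (m x)),
      𝒢.IsContinuousSystem m ∧
      ∀ g ∈ K, (((m (𝒢.source g)).map (𝒢.translate g)).toSignedMeasure -
        (m (𝒢.range g)).toSignedMeasure).totalVariation univ ≤ ENNReal.ofReal ε

/-- `p` exhibits the groupoid as a bundle of groupoids over `B`: it is continuous, and every arrow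
lies over the same point of `B` as its source and its range. -/
structure IsBundle {B : Type*} [TopologicalSpace B] (𝒢 : ArrowGroupoid G X) (p : G → B) :
    Prop where
  continuous : Continuous p
  source : ∀ g, p (𝒢.unit (𝒢.source g)) = p g
  range : ∀ g, p (𝒢.unit (𝒢.range g)) = p g

end ArrowGroupoid

/-! ### The groupoid attached to a torus action -/

section TorusAction

/-- The torus `𝕋ⁿ`. -/
abbrev Torus (n : ℕ) : Type := Fin n → Circle

/-- The duality bracket `⟨k, s⟩ = s₁^{k₁} ⋯ sₙ^{kₙ}` between `ℤⁿ` and `𝕋ⁿ`. -/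
noncomputable def dualityBracket {n : ℕ} (k : Fin n → ℤ) (s : Torus n) : Circle := ∏ i, s i ^ k i

/-- The common isotropy subgroup of the points of an orbit. -/
noncomputable def orbitIsotropy {n : ℕ} {M : Type*} [MulAction (Torus n) M]
    (q : MulAction.orbitRel.Quotient (Torus n) M) : Subgroup (Torus n) :=
  Quotient.liftOn' q (fun x => MulAction.stabilizer (Torus n) x) (by
    rintro _ b ⟨g, rfl⟩
    ext s
    simp only [MulAction.mem_stabilizer_iff]
    rw [smul_smul, mul_comm, ← smul_smul]
    exact smul_left_cancel_iff g)

/-- `Δ(k)`, inside the orbit space: the orbits on whose isotropy group `k` is trivial. -/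
def orbitsKilledBy {n : ℕ} (M : Type*) [MulAction (Torus n) M] (k : Fin n → ℤ) :
    Set (MulAction.orbitRel.Quotient (Torus n) M) :=
  {q | ∀ s ∈ orbitIsotropy q, dualityBracket k s = 1}

/-- The right action `(ħ, y).k = (ħ, β_{ħk}(y))` of `ℤⁿ` on `ℝ × N`; the action `β` of
`ℝⁿ` on `N` is written additively, `β_v(y) = v +ᵥ y`. -/
def integerAct {n : ℕ} {N : Type*} [AddAction (Fin n → ℝ) N]
    (p : ℝ × N) (k : Fin n → ℤ) : ℝ × N :=
  (p.1, (p.1 • fun i => (k i : ℝ)) +ᵥ p.2)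

theorem integerAct_add {n : ℕ} {N : Type*} [AddAction (Fin n → ℝ) N]
    (p : ℝ × N) (k l : Fin n → ℤ) :
    integerAct p (l + k) = integerAct (integerAct p k) l := by
  refine Prod.ext rfl ?_
  simp only [integerAct, vadd_vadd, ← smul_add]
  congr 2
  funext i
  simp

theorem integerAct_zero {n : ℕ} {N : Type*} [AddAction (Fin n → ℝ) N] (p : ℝ × N) :
    integerAct p (0 : Fin n → ℤ) = p := by
  refine Prod.ext rfl ?_
  have h : (p.1 • fun i : Fin n => (((0 : Fin n → ℤ) i : ℤ) : ℝ)) = 0 := by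
    funext i
    simp
  simp only [integerAct, h, zero_vadd]

theorem integerAct_neg {n : ℕ} {N : Type*} [AddAction (Fin n → ℝ) N]
    (p : ℝ × N) (k : Fin n → ℤ) : integerAct (integerAct p k) (-k) = p := by
  rw [← integerAct_add, neg_add_cancel, integerAct_zero]

/-- The crossed product groupoid `(ℝ × N) ⋊ ℤⁿ`: an arrow `(ħ, y, k)` has source `(ħ, y)` and
range `(ħ, y).k`, and `((ħ, y).k, l) ((ħ, y), k) = ((ħ, y), l + k)`. -/
def crossedGroupoid (n : ℕ) (N : Type*) [AddAction (Fin n → ℝ) N] :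
    ArrowGroupoid (ℝ × N × (Fin n → ℤ)) (ℝ × N) where
  source g := (g.1, g.2.1)
  range g := integerAct (g.1, g.2.1) g.2.2
  unit p := (p.1, p.2, 0)
  inv g := (g.1, (integerAct (g.1, g.2.1) g.2.2).2, -g.2.2)
  mul g h _ := (h.1, h.2.1, g.2.2 + h.2.2)
  source_unit _ := rfl
  range_unit p := integerAct_zero p
  source_inv _ := rfl
  range_inv g := integerAct_neg (g.1, g.2.1) g.2.2
  source_mul _ _ _ := rfl
  range_mul g h e := by
    rw [integerAct_add, ← e]
  mul_assoc _ _ _ _ _ := by simp [add_assoc]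
  unit_mul _ := by simp
  mul_unit _ := by simp
  inv_mul _ := by simp
  mul_inv g := by
    refine Prod.ext rfl (Prod.ext rfl ?_)
    simp

/-- The set `G` of all `(ħ, y, k)` such that `y` and `y' = β_{ħk}(y)` both lie in `Δ(k)` and have
the same isotropy group, where the orbit space `Δ` is placed in `N` by means of `ι`. -/
def deformationSet {n : ℕ} {M N : Type*} [MulAction (Torus n) M] [AddAction (Fin n → ℝ) N]
    (ι : MulAction.orbitRel.Quotient (Torus n) M → N) : Set (ℝ × N × (Fin n → ℤ)) :=
  {g | ∃ q q' : MulAction.orbitRel.Quotient (Torus n) M,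
    ι q = g.2.1 ∧ ι q' = (g.1 • fun i => (g.2.2 i : ℝ)) +ᵥ g.2.1 ∧
    q ∈ orbitsKilledBy M g.2.2 ∧ q' ∈ orbitsKilledBy M g.2.2 ∧
    orbitIsotropy q = orbitIsotropy q'}

/-- `G_k = G ∩ (ℝ × N × {k})`. -/
def deformationSlice {n : ℕ} {M N : Type*} [MulAction (Torus n) M] [AddAction (Fin n → ℝ) N]
    (ι : MulAction.orbitRel.Quotient (Torus n) M → N) (k : Fin n → ℤ) :
    Set (ℝ × N × (Fin n → ℤ)) :=
  deformationSet ι ∩ univ ×ˢ univ ×ˢ {k}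

end TorusAction

/-! ### Functions and measures on discrete spaces, and extension by zero -/

/-! The degree `(ħ, y, k) ↦ k` is a homomorphism `c : G → ℤⁿ`, and range and degree together embed
`G` topologically in `G⁽⁰⁾ × ℤⁿ`, because source and `k` are recovered continuously by acting with
`-k`. Everything rests on this embedding, abstracted as `IsGradedBy`.

The fibres of the range map inject into a discrete group, so they are discrete. Being étale then
means that the image of the embedding is open. If it is, a compactly supported continuous function
extends continuously by zero to `G⁽⁰⁾ × ℤⁿ`, and its fibre integrals are finite sums over degrees
(`isContinuousSystem_count`). Conversely, fibre integrals of a bump function of a single degree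
detect a neighbourhood of ranges (`isOpen_range_of_isEtale`). The slice of the image in degree `k`
is `r(G_k) = s(G_{-k})`, which gives the stated criterion.

For amenability, restricting Følner sets of `ℤⁿ` is not enough: the degrees occurring in a fibre may
form a sparse subset. Instead each arrow gets the largest weight of a factorization into arrows from
a compactly supported pool containing the given compact set `K`, each factor costing slightly less
than one. Prefixing an arrow of `K` loses at most that factor, while an arrow of large degree needs
many factors, so weights decay exponentially in the degree and are summable over `ℤⁿ`. Normalizing
gives the almost invariant probability measures. -/

/-- Extension by zero along an open embedding preserves continuity of compactly supported
functions. -/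
theorem Topology.IsOpenEmbedding.continuous_extend_zero {A B E : Type*} [TopologicalSpace A]
    [TopologicalSpace B] [T2Space B] [TopologicalSpace E] [Zero E] {e : A → B}
    (he : IsOpenEmbedding e) {f : A → E} (hf : Continuous f) (hs : HasCompactSupport f) :
    Continuous (Function.extend e f 0) := by
  refine continuous_of_tsupport fun b hb => ?_
  -- The image of the compact support is closed, `B` being Hausdorff, so continuity only has to be
  -- checked at points of the open image.
  obtain ⟨a, -, rfl⟩ := hs.tsupport_extend_zero_subset he.continuous hb
  rw [← he.continuousAt_iff, Function.extend_comp he.injective]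
  exact hf.continuousAt

theorem HasCompactSupport.finite_image {A B E : Type*} [TopologicalSpace A] [TopologicalSpace B]
    [DiscreteTopology B] [Zero E] {f : A → E} (hs : HasCompactSupport f) {c : A → B}
    (hc : Continuous c) : (c '' Function.support f).Finite :=
  (isCompact_iff_finite.1 (hs.isCompact.image hc)).subset
    (image_mono (subset_tsupport f))

theorem MeasureTheory.integral_count_eq_tsum {A E : Type*} [Countable A] [MeasurableSpace A]
    [MeasurableSingletonClass A] [NormedAddCommGroup E] [NormedSpace ℝ E] [CompleteSpace E]
    {f : A → E} (hf : (Function.support f).Finite) :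
    ∫ a, f a ∂Measure.count = ∑' a, f a := by
  rw [integral_countable]
  · simp [measureReal_def]
  · rw [integrable_count_iff]
    exact summable_of_hasFiniteSupport (hf.subset fun a ha => by simpa using ha)

theorem MeasureTheory.regular_count {A : Type*} [TopologicalSpace A] [DiscreteTopology A]
    [Countable A] [MeasurableSpace A] [BorelSpace A] : (Measure.count : Measure A).Regular := by
  have : IsLocallyFiniteMeasure (Measure.count : Measure A) :=
    ⟨fun a => ⟨{a}, by simp, by simp⟩⟩
  infer_instance

/-- Domination by a multiple close to one forces closeness of probability measures: `μ - ν` is at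
most `1 - t` on every set, and the Hahn decomposition contributes two such sets. -/
theorem MeasureTheory.totalVariation_sub_le {A : Type*} [MeasurableSpace A] {μ ν : Measure A}
    [IsProbabilityMeasure μ] [IsProbabilityMeasure ν] {t : ℝ}
    (h : ∀ s, MeasurableSet s → t * μ.real s ≤ ν.real s) (ht : t ≤ 1) :
    (μ.toSignedMeasure - ν.toSignedMeasure).totalVariation univ ≤ ENNReal.ofReal (2 * (1 - t)) := by
  have key : ∀ s, MeasurableSet s → |μ.real s - ν.real s| ≤ 1 - t := by
    have aux : ∀ s, MeasurableSet s → μ.real s - ν.real s ≤ 1 - t := fun s hs => by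
      have h1 := h s hs
      have h2 : μ.real s ≤ 1 := measureReal_le_one
      nlinarith
    intro s hs
    rw [abs_le]
    refine ⟨?_, aux s hs⟩
    -- Equal total mass turns the upper bound on the complement into the lower bound on `s`.
    have h1 := aux sᶜ hs.compl
    rw [probReal_compl_eq_one_sub hs, probReal_compl_eq_one_sub hs] at h1
    linarith
  obtain ⟨i, hi, hpos, hneg, hp, hn⟩ :=
    (μ.toSignedMeasure - ν.toSignedMeasure).toJordanDecomposition_spec
  have bound : ∀ s, MeasurableSet s → ‖(μ.toSignedMeasure - ν.toSignedMeasure) s‖ₑ ≤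
      ENNReal.ofReal (1 - t) := fun s hs => by
    rw [← ofReal_norm, Measure.toSignedMeasure_sub_apply hs, Real.norm_eq_abs]
    exact ENNReal.ofReal_le_ofReal (key s hs)
  rw [SignedMeasure.totalVariation, Measure.add_apply, hp, hn,
    SignedMeasure.toMeasureOfZeroLE_apply _ hpos hi .univ,
    SignedMeasure.toMeasureOfLEZero_apply _ hneg hi.compl .univ, two_mul,
    ENNReal.ofReal_add (by linarith) (by linarith)]
  refine add_le_add ?_ ?_
  · refine le_trans (le_of_eq ?_) (bound (i ∩ univ) (hi.inter .univ))
    rw [Real.enorm_of_nonneg, ENNReal.ofReal_eq_coe_nnreal]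
    exact VectorMeasure.nonneg_of_zero_le_restrict _
      (VectorMeasure.zero_le_restrict_subset _ hi inter_subset_left hpos)
  · refine le_trans (le_of_eq ?_) (bound (iᶜ ∩ univ) (hi.compl.inter .univ))
    rw [← enorm_neg, Real.enorm_of_nonneg, ENNReal.ofReal_eq_coe_nnreal]
    exact neg_nonneg.2 (VectorMeasure.nonpos_of_restrict_le_zero _
      (VectorMeasure.restrict_le_zero_subset _ hi.compl inter_subset_left hneg))

/-- The supremum of a sequence of continuous functions tending uniformly to zero is continuous. -/
theorem continuous_iSup_of_le_tendsto_zero {A : Type*} [TopologicalSpace A] {f : ℕ → A → NNReal}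
    (hf : ∀ i, Continuous (f i)) {u : ℕ → NNReal} (hu : Antitone u)
    (hu0 : Filter.Tendsto u Filter.atTop (𝓝 0)) (hfu : ∀ i a, f i a ≤ u i) :
    Continuous fun a => ⨆ i, f i a := by
  have hbdd : ∀ a, BddAbove (Set.range fun i => f i a) := fun a =>
    ⟨u 0, by rintro _ ⟨i, rfl⟩; exact (hfu i a).trans (hu (Nat.zero_le i))⟩
  have hcont : ∀ n : ℕ, Continuous fun a => (Finset.range n).sup fun i => f i a := fun n =>
    Continuous.finset_sup_apply fun i _ => hf i
  refine TendstoUniformly.continuous (p := Filter.atTop)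
    (F := fun (n : ℕ) a => (Finset.range n).sup fun i => f i a) ?_
    (Filter.Frequently.of_forall hcont)
  rw [Metric.tendstoUniformly_iff]
  intro ε hε
  filter_upwards [hu0.eventually (gt_mem_nhds (show (0 : NNReal) < ⟨ε, hε.le⟩ from hε))] with n hn a
  have h1 : ((Finset.range n).sup fun i => f i a) ≤ ⨆ i, f i a :=
    Finset.sup_le fun i _ => le_ciSup (hbdd a) i
  -- Terms with index at least `n` are bounded by `u n`, so the finite suprema converge uniformly.
  have h2 : ⨆ i, f i a ≤ ((Finset.range n).sup fun i => f i a) + u n := by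
    refine ciSup_le fun i => ?_
    rcases lt_or_ge i n with hi | hi
    · exact (Finset.le_sup (f := fun i => f i a) (Finset.mem_range.2 hi)).trans le_self_add
    · exact ((hfu i a).trans (hu hi)).trans le_add_self
  have h1' : (((Finset.range n).sup fun i => f i a : NNReal) : ℝ) ≤ (⨆ i, f i a : NNReal) := h1
  have h2' : ((⨆ i, f i a : NNReal) : ℝ) ≤ ((Finset.range n).sup fun i => f i a : NNReal) + u n :=
    h2
  have h3 : (u n : ℝ) < ε := hn
  rw [NNReal.dist_eq, abs_lt]
  constructor <;> linarith

/-- The sum factors into `n` two-sided geometric series. -/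
theorem summable_prod_pow_natAbs (n : ℕ) {ρ : NNReal} (hρ : ρ < 1) :
    Summable fun j : Fin n → ℤ => ρ ^ ∑ i, (j i).natAbs := by
  have h1 : Summable fun m : ℤ => (ρ : ℝ) ^ m.natAbs := by
    refine Summable.of_nat_of_neg ?_ ?_ <;>
    simpa using summable_geometric_of_lt_one ρ.2 hρ
  rw [← NNReal.summable_coe]
  push_cast
  induction n with
  | zero => exact Summable.of_finite
  | succ n ih =>
    rw [← (Fin.consEquiv fun _ => ℤ).summable_iff]
    refine (h1.mul_of_nonneg ih (fun _ => by positivity) (fun _ => by positivity)).congr ?_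
    rintro ⟨a, j⟩
    simp [Fin.sum_univ_succ, pow_add]

namespace ArrowGroupoid

/-! ### Groupoids embedded in the product of their unit space with a discrete group -/

theorem continuous_fiber_val {G X : Type*} [TopologicalSpace G] (𝒢 : ArrowGroupoid G X) (x : X) :
    Continuous (Fiber.val : 𝒢.Fiber x → G) := continuous_induced_dom

section Graded

variable {G X Γ : Type*} [TopologicalSpace G] [TopologicalSpace X] [AddCommGroup Γ]
  [TopologicalSpace Γ]

/-- A homomorphism `c` to a group which, together with the range map, separates the
arrows and induces their topology. -/
structure IsGradedBy (𝒢 : ArrowGroupoid G X) (c : G → Γ) : Prop where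
  isTopological : 𝒢.IsTopological
  map_mul : ∀ g h (e : 𝒢.source g = 𝒢.range h), c (𝒢.mul g h e) = c g + c h
  isEmbedding : IsEmbedding fun g => (𝒢.range g, c g)

namespace IsGradedBy

variable {𝒢 : ArrowGroupoid G X} {c : G → Γ}

theorem continuous (hc : 𝒢.IsGradedBy c) : Continuous c :=
  continuous_snd.comp hc.isEmbedding.continuous

theorem map_unit (hc : 𝒢.IsGradedBy c) (x : X) : c (𝒢.unit x) = 0 := by
  have h := hc.map_mul (𝒢.unit (𝒢.range (𝒢.unit x))) (𝒢.unit x) (𝒢.source_unit _)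
  rw [𝒢.unit_mul, 𝒢.range_unit] at h
  simpa using h

theorem map_inv (hc : 𝒢.IsGradedBy c) (g : G) : c (𝒢.inv g) = -c g := by
  have h := hc.map_mul (𝒢.inv g) g (𝒢.source_inv g)
  rw [𝒢.inv_mul, hc.map_unit] at h
  exact eq_neg_of_add_eq_zero_left h.symm

theorem ext (hc : 𝒢.IsGradedBy c) {g h : G} (hr : 𝒢.range g = 𝒢.range h) (hd : c g = c h) :
    g = h :=
  hc.isEmbedding.injective (Prod.ext hr hd)

theorem fiber_injective (hc : 𝒢.IsGradedBy c) (x : X) :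
    Function.Injective fun g : 𝒢.Fiber x => c g.val :=
  fun g h e => Subtype.ext (hc.ext (g.2.trans h.2.symm) e)

theorem discrete [DiscreteTopology Γ] (hc : 𝒢.IsGradedBy c) (x : X) :
    DiscreteTopology (𝒢.Fiber x) :=
  DiscreteTopology.of_continuous_injective
    (hc.continuous.comp (continuous_fiber_val 𝒢 x)) (hc.fiber_injective x)

theorem countable [Countable Γ] (hc : 𝒢.IsGradedBy c) (x : X) : Countable (𝒢.Fiber x) :=
  (hc.fiber_injective x).countable

theorem measurableSingletonClass [DiscreteTopology Γ] (hc : 𝒢.IsGradedBy c) (x : X) :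
    MeasurableSingletonClass (𝒢.Fiber x) :=
  have := hc.discrete x
  inferInstance

theorem translate_injective (hc : 𝒢.IsGradedBy c) (g : G) :
    Function.Injective (𝒢.translate g) := by
  intro h h' e
  refine hc.fiber_injective _ ?_
  have e' := congrArg (fun a => c a.val) e
  have h1 : c (𝒢.translate g h).val = c g + c h.val := hc.map_mul _ _ _
  have h2 : c (𝒢.translate g h').val = c g + c h'.val := hc.map_mul _ _ _
  simp only [h1, h2, add_right_inj] at e'
  exact e'

theorem translate_bijective (hc : 𝒢.IsGradedBy c) (g : G) :
    Function.Bijective (𝒢.translate g) := by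
  refine ⟨hc.translate_injective g, fun h => ?_⟩
  have e : 𝒢.source (𝒢.inv g) = 𝒢.range h.val := by rw [𝒢.source_inv]; exact h.2.symm
  refine ⟨⟨𝒢.mul (𝒢.inv g) h.val e, (𝒢.range_mul _ _ _).trans (𝒢.range_inv g)⟩, ?_⟩
  refine hc.fiber_injective _ ?_
  refine (hc.map_mul _ _ _).trans ?_
  change c g + c (𝒢.mul (𝒢.inv g) h.val e) = c h.val
  rw [hc.map_mul, hc.map_inv, add_neg_cancel_left]

/-- Sums over varying fibres become sums over the fixed index set `Γ`: `c` is injective on a fibre,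
and the extension vanishes at degrees that do not occur there. -/
theorem tsum_extend (hc : 𝒢.IsGradedBy c) {E : Type*} [AddCommMonoid E] [TopologicalSpace E]
    (f : G → E) (x : X) :
    ∑' k, Function.extend (fun g => (𝒢.range g, c g)) f 0 (x, k) =
      ∑' h : 𝒢.Fiber x, f h.val := by
  rw [← (hc.fiber_injective x).tsum_eq]
  · refine tsum_congr fun h => ?_
    have e : (x, c h.val) = (fun g => (𝒢.range g, c g)) h.val := Prod.ext h.2.symm rfl
    rw [e, hc.isEmbedding.injective.extend_apply]
  · intro k hk
    by_contra hne
    refine hk (Function.extend_apply' _ _ _ ?_)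
    rintro ⟨g, hg⟩
    obtain ⟨rfl, rfl⟩ := Prod.ext_iff.1 hg
    exact hne ⟨⟨g, rfl⟩, rfl⟩

variable [DiscreteTopology Γ]

theorem map_count_translate (hc : 𝒢.IsGradedBy c) (g : G) :
    (Measure.count : Measure (𝒢.Fiber (𝒢.source g))).map (𝒢.translate g) = Measure.count := by
  have := hc.discrete (𝒢.source g)
  have := hc.discrete (𝒢.range g)
  ext s hs
  rw [Measure.map_apply continuous_of_discreteTopology.measurable hs,
    Measure.count_apply hs,
    Measure.count_apply (continuous_of_discreteTopology.measurable hs)]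
  congr 1
  exact encard_preimage_of_bijective (hc.translate_bijective g) s

theorem finite_support_fiber (hc : 𝒢.IsGradedBy c) {E : Type*} [Zero E] {f : G → E}
    (hs : HasCompactSupport f) (x : X) :
    (Function.support fun h : 𝒢.Fiber x => f h.val).Finite := by
  refine Finite.of_finite_image (f := fun h => c h.val) ((hs.finite_image hc.continuous).subset ?_)
    (hc.fiber_injective x).injOn
  rintro _ ⟨h, hh, rfl⟩
  exact ⟨h.val, hh, rfl⟩

variable [Countable Γ]

theorem integral_count_fiber (hc : 𝒢.IsGradedBy c) {f : G → ℂ} (hs : HasCompactSupport f) (x : X) :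
    ∫ h : 𝒢.Fiber x, f h.val ∂Measure.count =
      ∑' k, Function.extend (fun g => (𝒢.range g, c g)) f 0 (x, k) := by
  have := hc.countable x
  have := hc.measurableSingletonClass x
  rw [integral_count_eq_tsum (hc.finite_support_fiber hs x), hc.tsum_extend]

/-- Compact support meets only finitely many degrees, so the fibre integral is a finite sum of
slices of one continuous function on `X × Γ`. -/
theorem isContinuousSystem_count [T2Space X] (hc : 𝒢.IsGradedBy c)
    (ho : IsOpen (Set.range fun g => (𝒢.range g, c g))) :
    𝒢.IsContinuousSystem fun _ => Measure.count where
  regular x :=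
    have := hc.countable x
    have := hc.discrete x
    regular_count
  continuous_integral f hf hs := by
    simp_rw [hc.integral_count_fiber hs]
    have he := IsOpenEmbedding.continuous_extend_zero ⟨hc.isEmbedding, ho⟩ hf hs
    have hfin := hs.finite_image hc.continuous
    have hsum : ∀ x, ∑' k, Function.extend (fun g => (𝒢.range g, c g)) f 0 (x, k) =
        ∑ k ∈ hfin.toFinset, Function.extend (fun g => (𝒢.range g, c g)) f 0 (x, k) := by
      refine fun x => tsum_eq_sum fun k hk => ?_
      by_cases hx : ∃ g, (𝒢.range g, c g) = (x, k)
      · obtain ⟨g, hg⟩ := hx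
        obtain ⟨rfl, rfl⟩ := Prod.ext_iff.1 hg
        rw [hc.isEmbedding.injective.extend_apply]
        by_contra hne
        exact hk (hfin.mem_toFinset.2 ⟨g, hne, rfl⟩)
      · exact Function.extend_apply' _ _ _ hx
    simp_rw [hsum]
    exact continuous_finsetSum _ fun k _ => he.comp (by fun_prop)

theorem isEtale [T2Space X] [LocallyCompactSpace X] [SecondCountableTopology X]
    (hc : 𝒢.IsGradedBy c) (ho : IsOpen (Set.range fun g => (𝒢.range g, c g))) : 𝒢.IsEtale where
  isTopological := hc.isTopological
  locallyCompact := IsOpenEmbedding.locallyCompactSpace ⟨hc.isEmbedding, ho⟩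
  hausdorff := hc.isEmbedding.t2Space
  separable :=
    have : SecondCountableTopology Γ := inferInstance
    hc.isEmbedding.secondCountableTopology
  discrete := hc.discrete
  haar_count :=
    { hc.isContinuousSystem_count ho with
      fullSupport := fun _ => ⟨fun _ _ hU => Measure.count_ne_zero hU⟩
      invariant := hc.map_count_translate }

/-- A bump function at `g` confined to the degree of `g` has a continuous fibre integral that equals
one at the range of `g`. Wherever this integral is nonzero, an arrow of the same degree must exist.
-/
theorem isOpen_range_of_isEtale (hc : 𝒢.IsGradedBy c) (h : 𝒢.IsEtale) :
    IsOpen (Set.range fun g => (𝒢.range g, c g)) := by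
  have := h.locallyCompact
  have := h.hausdorff
  rw [isOpen_iff_mem_nhds]
  rintro _ ⟨g, rfl⟩
  obtain ⟨f, hf1, hf0, hs, -⟩ := exists_continuous_one_zero_of_isCompact (isCompact_singleton (x := g))
    (((isOpen_discrete {c g}).preimage hc.continuous).isClosed_compl)
    (by simp)
  have hs' : HasCompactSupport fun a => (f a : ℂ) := hs.comp_left (g := ((↑) : ℝ → ℂ)) (by simp)
  have hF := h.haar_count.continuous_integral (fun a => (f a : ℂ)) (by fun_prop) hs'
  simp_rw [hc.integral_count_fiber hs'] at hF
  have hval : ∀ x k, Function.extend (fun g => (𝒢.range g, c g)) (fun a => (f a : ℂ)) 0 (x, k) ≠ 0 →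
      k = c g ∧ ∃ a, 𝒢.range a = x ∧ c a = c g := by
    intro x k hk
    have : ∃ a, (𝒢.range a, c a) = (x, k) := by
      by_contra hne
      exact hk (Function.extend_apply' _ _ _ hne)
    obtain ⟨a, ha⟩ := this
    obtain ⟨rfl, rfl⟩ := Prod.ext_iff.1 ha
    rw [hc.isEmbedding.injective.extend_apply] at hk
    have : c a = c g := by
      by_contra hne
      exact hk (by simp [hf0 (show a ∈ (c ⁻¹' {c g})ᶜ from hne)])
    exact ⟨this, a, rfl, this⟩
  have hU := hF.isOpen_preimage {0}ᶜ isOpen_compl_singleton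
  refine Filter.mem_of_superset (prod_mem_nhds (hU.mem_nhds ?_) (mem_nhds_discrete.2 rfl :
    {c g} ∈ 𝓝 (c g))) ?_
  · change (∑' k, _) ≠ (0 : ℂ)
    rw [tsum_eq_single (c g) fun k hk => by_contra fun hne => hk (hval _ k hne).1,
      hc.isEmbedding.injective.extend_apply, hf1 rfl]
    simp
  · rintro ⟨x, k⟩ ⟨hx, rfl⟩
    have : ∃ l, Function.extend (fun g => (𝒢.range g, c g)) (fun a => (f a : ℂ)) 0 (x, l) ≠ 0 := by
      by_contra! hne
      exact hx (by simp [hne])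
    obtain ⟨l, hl⟩ := this
    obtain ⟨-, a, ha, ha'⟩ := hval x l hl
    exact ⟨a, Prod.ext ha ha'⟩

end IsGradedBy

end Graded

end ArrowGroupoid

namespace ArrowGroupoid

/-! ### Amenability of groupoids graded by a free abelian group -/

section Amenable

variable {G X : Type*}

/-- The supremum, over all factorizations of the arrow of range `x` and degree `j` into `N` arrows
with degrees in `F`, of the product of the values of `b` along the factorization. -/
noncomputable def pathWeight {Γ : Type*} [AddCommGroup Γ] (𝒢 : ArrowGroupoid G X) (c : G → Γ)
    (b : G → NNReal) (F : Finset Γ) : ℕ → Γ → X → NNReal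
  | 0, j, _ => indicator {0} 1 j
  | N + 1, j, x => F.sup fun k => Function.extend (fun g => (𝒢.range g, c g))
      (fun g => b g * pathWeight 𝒢 c b F N (j - k) (𝒢.source g)) 0 (x, k)

variable [TopologicalSpace G] [TopologicalSpace X]

namespace IsGradedBy

/-! ### Weights of factorizations of bounded length. -/

section PathWeight

variable {Γ : Type*} [AddCommGroup Γ] [TopologicalSpace Γ] {𝒢 : ArrowGroupoid G X} {c : G → Γ}
  {b : G → NNReal} {F : Finset Γ}

theorem extend_ne_zero {E : Type*} [Zero E] (hc : 𝒢.IsGradedBy c) {f : G → E} {x : X} {k : Γ}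
    (h : Function.extend (fun g => (𝒢.range g, c g)) f 0 (x, k) ≠ 0) :
    ∃ g, 𝒢.range g = x ∧ c g = k ∧
      Function.extend (fun g => (𝒢.range g, c g)) f 0 (x, k) = f g := by
  by_cases hx : ∃ g, (𝒢.range g, c g) = (x, k)
  · obtain ⟨g, hg⟩ := hx
    obtain ⟨rfl, rfl⟩ := Prod.ext_iff.1 hg
    exact ⟨g, rfl, rfl, hc.isEmbedding.injective.extend_apply _ _ _⟩
  · exact absurd (Function.extend_apply' _ _ _ hx) h

/-- A finite supremum is attained, and a nonzero value of an extension by zero comes from an actual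
arrow, the first factor. -/
theorem exists_of_pathWeight_succ_ne_zero (hc : 𝒢.IsGradedBy c) {N : ℕ} {j : Γ} {x : X}
    (h : pathWeight 𝒢 c b F (N + 1) j x ≠ 0) :
    ∃ g, 𝒢.range g = x ∧ c g ∈ F ∧ pathWeight 𝒢 c b F N (j - c g) (𝒢.source g) ≠ 0 ∧
      pathWeight 𝒢 c b F (N + 1) j x =
        b g * pathWeight 𝒢 c b F N (j - c g) (𝒢.source g) := by
  have hF : F.Nonempty := by
    by_contra hne
    rw [Finset.not_nonempty_iff_eq_empty] at hne
    subst hne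
    exact h (by simp [pathWeight])
  obtain ⟨k, hk, e⟩ := Finset.exists_mem_eq_sup F hF fun k =>
    Function.extend (fun g => (𝒢.range g, c g))
      (fun g => b g * pathWeight 𝒢 c b F N (j - k) (𝒢.source g)) 0 (x, k)
  change pathWeight 𝒢 c b F (N + 1) j x = _ at e
  rw [e] at h
  obtain ⟨g, hg, rfl, e'⟩ := hc.extend_ne_zero h
  rw [e'] at h
  exact ⟨g, hg, hk, right_ne_zero_of_mul h, e.trans e'⟩

theorem le_pathWeight_succ (hc : 𝒢.IsGradedBy c) (N : ℕ) (j : Γ) {g : G} (hg : c g ∈ F) :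
    b g * pathWeight 𝒢 c b F N j (𝒢.source g) ≤
      pathWeight 𝒢 c b F (N + 1) (c g + j) (𝒢.range g) := by
  refine le_trans (le_of_eq ?_) (Finset.le_sup hg)
  simp only [add_sub_cancel_left]
  exact (hc.isEmbedding.injective.extend_apply
    (fun a => b a * pathWeight 𝒢 c b F N j (𝒢.source a)) 0 g).symm

/-- The factor `b` makes each term of the supremum compactly supported on `G`, so extension by zero
along the open embedding keeps it continuous. -/
theorem continuous_pathWeight [T2Space X] (hc : 𝒢.IsGradedBy c)
    (ho : IsOpen (Set.range fun g => (𝒢.range g, c g))) [T2Space Γ] (hb : Continuous b)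
    (hs : HasCompactSupport b) (N : ℕ) (j : Γ) : Continuous (pathWeight 𝒢 c b F N j) := by
  induction N generalizing j with
  | zero => exact continuous_const
  | succ N ih =>
    refine Continuous.finset_sup_apply fun k _ => ?_
    have h := IsOpenEmbedding.continuous_extend_zero ⟨hc.isEmbedding, ho⟩
      (hb.mul ((ih (j - k)).comp hc.isTopological.continuous_source)) hs.mul_right
    exact h.comp (by fun_prop : Continuous fun x : X => (x, k))

theorem pathWeight_le (hc : 𝒢.IsGradedBy c) {θ : NNReal} (hb : ∀ g, b g ≤ θ) (N : ℕ) (j : Γ)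
    (x : X) : pathWeight 𝒢 c b F N j x ≤ θ ^ N := by
  induction N generalizing j x with
  | zero => exact (indicator_le_self' (f := (1 : Γ → NNReal)) (fun _ _ => zero_le) j).trans (by simp)
  | succ N ih =>
    by_cases h : pathWeight 𝒢 c b F (N + 1) j x = 0
    · rw [h]; exact zero_le
    · obtain ⟨g, -, -, -, e⟩ := hc.exists_of_pathWeight_succ_ne_zero h
      rw [e, pow_succ']
      exact mul_le_mul' (hb g) (ih _ _)

theorem exists_of_pathWeight_ne_zero (hc : 𝒢.IsGradedBy c) {N : ℕ} {j : Γ} {x : X}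
    (h : pathWeight 𝒢 c b F N j x ≠ 0) : ∃ g, 𝒢.range g = x ∧ c g = j := by
  induction N generalizing j x with
  | zero =>
    have : j = 0 := mem_of_indicator_ne_zero (f := (1 : Γ → NNReal)) (s := {0}) h
    exact ⟨𝒢.unit x, 𝒢.range_unit x, this ▸ hc.map_unit x⟩
  | succ N ih =>
    obtain ⟨g, rfl, -, h', -⟩ := hc.exists_of_pathWeight_succ_ne_zero h
    obtain ⟨g', hr, hd⟩ := ih h'
    exact ⟨𝒢.mul g g' hr.symm, 𝒢.range_mul _ _ _, by rw [hc.map_mul, hd, add_sub_cancel]⟩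

end PathWeight

/-! ### Decay of the weights in the degree, and the approximate invariant mean. -/

variable {n : ℕ} {𝒢 : ArrowGroupoid G X} {c : G → Fin n → ℤ}

/-- This is the triangle inequality for the `ℓ¹` norm along a factorization. -/
theorem sum_natAbs_le_of_pathWeight_ne_zero (hc : 𝒢.IsGradedBy c) {b : G → NNReal}
    {F : Finset (Fin n → ℤ)} {R : ℕ} (hR : ∀ k ∈ F, ∑ i, (k i).natAbs ≤ R) {N : ℕ}
    {j : Fin n → ℤ} {x : X} (h : pathWeight 𝒢 c b F N j x ≠ 0) :
    ∑ i, (j i).natAbs ≤ R * N := by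
  induction N generalizing j x with
  | zero =>
    have : j = 0 := mem_of_indicator_ne_zero (f := (1 : (Fin n → ℤ) → NNReal)) (s := {0}) h
    simp [this]
  | succ N ih =>
    obtain ⟨g, -, hF, h', -⟩ := hc.exists_of_pathWeight_succ_ne_zero h
    calc ∑ i, (j i).natAbs ≤ ∑ i, (((c g) i).natAbs + ((j - c g) i).natAbs) := by
          refine Finset.sum_le_sum fun i _ => ?_
          simp only [Pi.sub_apply]
          omega
      _ ≤ R + R * N := by
          rw [Finset.sum_add_distrib]
          exact add_le_add (hR _ hF) (ih h')
      _ = R * (N + 1) := by ring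

/-- A summable, continuous family of weights on the arrows, almost invariant under `K`. -/
theorem exists_weight [T2Space X] [T2Space G] [LocallyCompactSpace G] (hc : 𝒢.IsGradedBy c)
    (ho : IsOpen (Set.range fun g => (𝒢.range g, c g))) {K : Set G} (hK : IsCompact K) {t : NNReal}
    (ht : t < 1) :
    ∃ W : (Fin n → ℤ) → X → NNReal, (∀ j, Continuous (W j)) ∧
      (∃ u : (Fin n → ℤ) → NNReal, Summable u ∧ ∀ j x, W j x ≤ u j) ∧ (∀ x, W 0 x ≠ 0) ∧
      (∀ j x, W j x ≠ 0 → ∃ g, 𝒢.range g = x ∧ c g = j) ∧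
      ∀ g ∈ K, ∀ j, t * W j (𝒢.source g) ≤ W (c g + j) (𝒢.range g) := by
  obtain ⟨f, hf1, -, hs, hf⟩ := exists_continuous_one_zero_of_isCompact hK isClosed_empty
    (disjoint_empty K)
  have hfin := hs.finite_image hc.continuous
  set F := hfin.toFinset with hFdef
  -- The added one keeps `R` positive, so that `ρ ^ R < 1` even if all degrees in `F` vanish.
  set R := F.sup (fun k => ∑ i, (k i).natAbs) + 1 with hRdef
  have hR : ∀ k ∈ F, ∑ i, (k i).natAbs ≤ R := fun k hk =>
    (Finset.le_sup (f := fun k : Fin n → ℤ => ∑ i, (k i).natAbs) hk).trans (Nat.le_succ _)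
  obtain ⟨ρ, hρ1, hρt⟩ : ∃ ρ : NNReal, ρ < 1 ∧ t < ρ ^ R := by
    have h1 : ∀ᶠ ρ : NNReal in 𝓝[<] 1, t < ρ ^ R :=
      ((continuous_pow R).tendsto' (1 : NNReal) 1 (one_pow R)).mono_left nhdsWithin_le_nhds
        |>.eventually (lt_mem_nhds ht)
    have : (𝓝[<] (1 : NNReal)).NeBot := nhdsLT_neBot_of_exists_lt ⟨0, one_pos⟩
    obtain ⟨ρ, h, h'⟩ := (h1.and self_mem_nhdsWithin).exists
    exact ⟨ρ, h', h⟩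
  have hθ1 : ρ ^ R < 1 := pow_lt_one₀ (zero_le) hρ1 (by omega)
  -- One factor costs at least `ρ ^ R`, with equality on `K`; the exponent `R` pays for the largest
  -- possible degree of a factor.
  set b : G → NNReal := fun g => ρ ^ R * (f g).toNNReal with hbdef
  have hbc : Continuous b := by fun_prop
  have hbs : HasCompactSupport b :=
    (hs.comp_left (g := fun r : ℝ => ρ ^ R * r.toNNReal) (by simp) :)
  have hb1 : ∀ g, b g ≤ ρ ^ R := fun g =>
    mul_le_of_le_one_right (zero_le) (Real.toNNReal_le_one.2 (hf g).2)
  have hbF : ∀ g ∈ K, c g ∈ F := fun g hg => by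
    refine hfin.mem_toFinset.2 ⟨g, ?_, rfl⟩
    simp [hf1 hg]
  have hbK : ∀ g ∈ K, b g = ρ ^ R := fun g hg => by simp [hbdef, hf1 hg]
  have hle : ∀ N j x, pathWeight 𝒢 c b F N j x ≤ (ρ ^ R) ^ N := hc.pathWeight_le hb1
  have hbdd : ∀ j x, BddAbove (Set.range fun N => pathWeight 𝒢 c b F N j x) := fun j x =>
    ⟨1, by rintro _ ⟨N, rfl⟩; exact (hle N j x).trans (pow_le_one₀ (zero_le) hθ1.le)⟩
  refine ⟨fun j x => ⨆ N, pathWeight 𝒢 c b F N j x, fun j => ?_,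
    ⟨_, summable_prod_pow_natAbs n hρ1, fun j x => ciSup_le fun N => ?_⟩, fun x => ?_,
    fun j x h => ?_, fun g hg j => ?_⟩
  · exact continuous_iSup_of_le_tendsto_zero (fun N => hc.continuous_pathWeight ho hbc hbs N j)
      (pow_right_anti₀ (zero_le) hθ1.le) (NNReal.tendsto_pow_atTop_nhds_zero_of_lt_one hθ1)
      (fun N x => hle N j x)
  · by_cases h : pathWeight 𝒢 c b F N j x = 0
    · rw [h]; exact zero_le
    · refine (hle N j x).trans ?_
      rw [← pow_mul]
      -- A nonzero weight of length `N` forces the norm of `j` to be at most `R * N`, so `ρ ^ (R *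
      -- N)` is at most `ρ` to that norm.
      exact pow_le_pow_of_le_one (zero_le) hρ1.le (hc.sum_natAbs_le_of_pathWeight_ne_zero hR h)
  · refine ne_of_gt (lt_of_lt_of_le one_pos ?_)
    exact le_trans (by simp [pathWeight]) (le_ciSup (hbdd 0 x) 0)
  · by_contra hne
    refine h ?_
    have : ∀ N, pathWeight 𝒢 c b F N j x = 0 := fun N => by
      by_contra hN
      exact hne (hc.exists_of_pathWeight_ne_zero hN)
    simp [this]
  · refine (mul_le_mul_left hρt.le _).trans ?_
    rw [NNReal.mul_iSup]
    refine ciSup_le fun N => ?_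
    rw [← hbK g hg]
    exact (hc.le_pathWeight_succ N j (hbF g hg)).trans (le_ciSup (hbdd _ _) (N + 1))

theorem isAmenable [T2Space X] [T2Space G] [LocallyCompactSpace G] (hc : 𝒢.IsGradedBy c)
    (ho : IsOpen (Set.range fun g => (𝒢.range g, c g))) : 𝒢.IsAmenable := by
  intro K hK ε hε
  -- One factor `t` is lost on the weights and another on their normalization, whence `t * t`.
  obtain ⟨t, ht1, htε⟩ : ∃ t : NNReal, t < 1 ∧ 2 * (1 - (t * t : NNReal) : ℝ) < ε := by
    have h1 : ∀ᶠ t : NNReal in 𝓝[<] 1, 2 * (1 - (t * t : NNReal) : ℝ) < ε := by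
      have : Continuous fun t : NNReal => 2 * (1 - (t * t : NNReal) : ℝ) := by fun_prop
      exact (this.tendsto' 1 0 (by simp)).mono_left nhdsWithin_le_nhds
        |>.eventually (gt_mem_nhds hε)
    have : (𝓝[<] (1 : NNReal)).NeBot := nhdsLT_neBot_of_exists_lt ⟨0, one_pos⟩
    obtain ⟨t, h, h'⟩ := (h1.and self_mem_nhdsWithin).exists
    exact ⟨t, h', h⟩
  -- Inverses are included because comparing the total masses `Z` needs the estimate for `g⁻¹`.
  obtain ⟨W, hWc, ⟨u, hu, hWu⟩, hW0, hWs, hWK⟩ := hc.exists_weight ho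
    (hK.union (hK.image hc.isTopological.continuous_inv)) ht1
  have hsum : ∀ x, Summable fun j => W j x := fun x =>
    NNReal.summable_of_le (fun j => hWu j x) hu
  set Z : X → NNReal := fun x => ∑' j, W j x with hZ
  have hZ0 : ∀ x, Z x ≠ 0 := fun x h =>
    hW0 x (le_antisymm (((hsum x).le_tsum 0 fun _ _ => zero_le).trans h.le) (zero_le))
  have hZc : Continuous Z := by
    have : (fun x => (Z x : ℝ)) = fun x => ∑' j, (W j x : ℝ) := by
      funext x; exact NNReal.coe_tsum
    refine NNReal.isEmbedding_coe.continuous_iff.2 ?_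
    change Continuous fun x => (Z x : ℝ)
    rw [this]
    refine continuous_tsum (fun j => NNReal.continuous_coe.comp (hWc j)) (NNReal.summable_coe.2 hu)
      fun j x => ?_
    rw [Real.norm_of_nonneg (NNReal.coe_nonneg _)]
    exact hWu j x
  set w : G → NNReal := fun g => W (c g) (𝒢.range g) / Z (𝒢.range g) with hw
  have hwc : Continuous w := by
    have h1 : Continuous fun p : X × (Fin n → ℤ) => W p.2 p.1 :=
      continuous_prod_of_discrete_right.2 hWc
    exact (h1.comp hc.isEmbedding.continuous).div
      (hZc.comp hc.isTopological.continuous_range) fun _ => hZ0 _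
  have hmeas : ∀ {x : X} {β : Type} [MeasurableSpace β] [TopologicalSpace β] [BorelSpace β]
      (f : 𝒢.Fiber x → β), Measurable f := fun {x} {β} _ _ _ f =>
    have := hc.discrete x
    continuous_of_discreteTopology.measurable
  have hset : ∀ {x : X} (s : Set (𝒢.Fiber x)), MeasurableSet s := fun {x} s =>
    have := hc.discrete x
    (isOpen_discrete s).measurableSet
  set m : ∀ x, Measure (𝒢.Fiber x) := fun x =>
    Measure.count.withDensity fun h => (w h.val : ENNReal) with hm
  have hprob : ∀ x, IsProbabilityMeasure (m x) := fun x => by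
    have := hc.measurableSingletonClass x
    constructor
    have h1 : ∑' h : 𝒢.Fiber x, W (c h.val) x = Z x := by
      refine (hc.fiber_injective x).tsum_eq (f := fun j => W j x) fun j hj => ?_
      obtain ⟨g, hg, hj⟩ := hWs j x hj
      exact ⟨⟨g, hg⟩, hj⟩
    have h2 : Summable fun h : 𝒢.Fiber x => W (c h.val) x :=
      NNReal.summable_comp_injective (hsum x) (hc.fiber_injective x)
    rw [hm, withDensity_apply _ .univ, Measure.restrict_univ, lintegral_count]
    have h3 : ∀ h : 𝒢.Fiber x, w h.val = W (c h.val) x / Z x := fun h => by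
      have := h.2
      change 𝒢.range h.val = x at this
      simp only [hw, this]
    simp_rw [h3]
    rw [← ENNReal.coe_tsum (h2.div_const _), tsum_div_const, h1, div_self (hZ0 x), ENNReal.coe_one]
  refine ⟨m, hprob, ⟨fun x => ?_, fun f hf hs => ?_⟩, fun g hg => ?_⟩
  · have := hc.discrete x
    have := hc.countable x
    infer_instance
  · have h1 := (hc.isContinuousSystem_count ho).continuous_integral (fun g => w g • f g)
      (hwc.smul hf) hs.smul_left
    refine h1.congr fun x => ?_
    exact (integral_withDensity_eq_integral_smul (hmeas fun h : 𝒢.Fiber x => w h.val) _).symm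
  · have hT : Measurable (𝒢.translate g) := fun s _ => hset _
    have : IsProbabilityMeasure ((m (𝒢.source g)).map (𝒢.translate g)) :=
      Measure.isProbabilityMeasure_map hT.aemeasurable
    have hZg : t * Z (𝒢.range g) ≤ Z (𝒢.source g) := by
      have h1 := hWK _ (mem_union_right _ (mem_image_of_mem _ hg))
      simp only [𝒢.source_inv, 𝒢.range_inv] at h1
      calc t * Z (𝒢.range g) = ∑' j, t * W j (𝒢.range g) := (NNReal.tsum_mul_left _ _).symm
        _ ≤ ∑' j, W (c (𝒢.inv g) + j) (𝒢.source g) :=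
          ((hsum _).mul_left t).tsum_le_tsum h1
            ((Equiv.addLeft (c (𝒢.inv g))).summable_iff.2 (hsum (𝒢.source g)))
        _ = Z (𝒢.source g) :=
          (Equiv.addLeft (c (𝒢.inv g))).tsum_eq fun j => W j (𝒢.source g)
    have hwg : ∀ h : 𝒢.Fiber (𝒢.source g), t * t * w h.val ≤ w (𝒢.translate g h).val := by
      intro h
      have e1 : 𝒢.range h.val = 𝒢.source g := h.2
      have e2 : 𝒢.range (𝒢.translate g h).val = 𝒢.range g := (𝒢.translate g h).2
      have e3 : c (𝒢.translate g h).val = c g + c h.val := hc.map_mul _ _ _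
      have h2 := hWK g (mem_union_left _ hg) (c h.val)
      simp only [hw, e1, e2, e3]
      rw [← mul_div_assoc, div_le_div_iff₀ (pos_iff_ne_zero.2 (hZ0 _)) (pos_iff_ne_zero.2 (hZ0 _))]
      calc t * t * W (c h.val) (𝒢.source g) * Z (𝒢.range g)
          = (t * W (c h.val) (𝒢.source g)) * (t * Z (𝒢.range g)) := by ring
        _ ≤ _ := mul_le_mul' h2 hZg
    refine (totalVariation_sub_le (t := (t * t : NNReal)) (fun s hs => ?_) ?_).trans
      (ENNReal.ofReal_le_ofReal htε.le)
    · have hle : ((t * t : NNReal) : ENNReal) * ((m (𝒢.source g)).map (𝒢.translate g)) s ≤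
          m (𝒢.range g) s := by
        -- Translation preserves counting measure, so comparing the two measures reduces to
        -- comparing densities pointwise.
        have hinv : (Measure.count : Measure (𝒢.Fiber (𝒢.source g))).map (𝒢.translate g) =
            Measure.count := hc.map_count_translate g
        rw [Measure.map_apply hT hs]
        simp only [hm]
        rw [withDensity_apply _ hs, withDensity_apply _ (hset _), ← hinv,
          setLIntegral_map hs (hmeas _) hT, ← lintegral_const_mul _ (hmeas _)]
        refine lintegral_mono fun h => ?_
        rw [← ENNReal.coe_mul]
        exact ENNReal.coe_le_coe.2 (hwg h)
      have := ENNReal.toReal_mono (measure_ne_top _ _) hle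
      rwa [ENNReal.toReal_mul] at this
    · exact_mod_cast mul_le_one' ht1.le ht1.le

end IsGradedBy

end Amenable

end ArrowGroupoid

/-! ### The subgroupoid attached to a torus action -/

theorem dualityBracket_zero {n : ℕ} (s : Torus n) : dualityBracket 0 s = 1 := by
  simp [dualityBracket]

theorem dualityBracket_add {n : ℕ} (k l : Fin n → ℤ) (s : Torus n) :
    dualityBracket (k + l) s = dualityBracket k s * dualityBracket l s := by
  simp [dualityBracket, zpow_add, Finset.prod_mul_distrib]

theorem dualityBracket_neg {n : ℕ} (k : Fin n → ℤ) (s : Torus n) :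
    dualityBracket (-k) s = (dualityBracket k s)⁻¹ := by
  simp [dualityBracket, Finset.prod_inv_distrib]

theorem continuous_integerAct {n : ℕ} {N : Type*} [TopologicalSpace N] [AddAction (Fin n → ℝ) N]
    [ContinuousVAdd (Fin n → ℝ) N] :
    Continuous fun p : (ℝ × N) × (Fin n → ℤ) => integerAct p.1 p.2 := by
  have h : Continuous fun k : Fin n → ℤ => fun i => (k i : ℝ) :=
    continuous_pi fun i => (continuous_of_discreteTopology (f := ((↑) : ℤ → ℝ))).comp
      (continuous_apply i)
  unfold integerAct
  exact (continuous_fst.comp continuous_fst).prodMk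
    (((continuous_fst.comp continuous_fst).smul (h.comp continuous_snd)).vadd
      (continuous_snd.comp continuous_fst))

section DeformationGroupoid

variable {n : ℕ} {M N : Type*} [MulAction (Torus n) M] [AddAction (Fin n → ℝ) N]
  {ι : MulAction.orbitRel.Quotient (Torus n) M → N}

/-- Injectivity of `ι` identifies the middle orbit, so all three orbits share one isotropy group, on
which both characters, hence their product, are trivial. -/
theorem deformationSet_mul_mem (hι : Function.Injective ι) (g h : ℝ × N × (Fin n → ℤ))
    (e : (crossedGroupoid n N).source g = (crossedGroupoid n N).range h)
    (hg : g ∈ deformationSet ι) (hh : h ∈ deformationSet ι) :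
    (crossedGroupoid n N).mul g h e ∈ deformationSet ι := by
  have hr := (crossedGroupoid n N).range_mul g h e
  obtain ⟨q, q', hq, hq', hk, hk', hqq'⟩ := hg
  obtain ⟨p, p', hp, hp', hl, hl', hpp'⟩ := hh
  obtain rfl : p' = q := hι (hp'.trans ((congrArg Prod.snd e).symm.trans hq.symm))
  refine ⟨p, q', hp, ?_, fun s hs => ?_, fun s hs => ?_, hpp'.trans hqq'⟩
  · exact hq'.trans (congrArg Prod.snd hr).symm
  · exact (dualityBracket_add _ _ s).trans (by rw [hk s (hpp' ▸ hs), hl s hs, one_mul])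
  · exact (dualityBracket_add _ _ s).trans
      (by rw [hk' s hs, hl' s (hqq' ▸ hs), one_mul])

theorem deformationSet_inv_mem (g : ℝ × N × (Fin n → ℤ)) (hg : g ∈ deformationSet ι) :
    (crossedGroupoid n N).inv g ∈ deformationSet ι := by
  have hr := (crossedGroupoid n N).range_inv g
  obtain ⟨q, q', hq, hq', hk, hk', hqq'⟩ := hg
  refine ⟨q', q, hq', ?_, fun s hs => ?_, fun s hs => ?_, hqq'.symm⟩
  · exact hq.trans (congrArg Prod.snd hr).symm
  · exact (dualityBracket_neg _ s).trans (by rw [hk' s hs, inv_one])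
  · exact (dualityBracket_neg _ s).trans (by rw [hk s hs, inv_one])

/-- The set `deformationSet ι`, as a subgroupoid of the crossed product. -/
def deformationSub (hι : Function.Injective ι) : (crossedGroupoid n N).Sub where
  carrier := deformationSet ι
  mul_mem := deformationSet_mul_mem hι
  inv_mem := deformationSet_inv_mem

theorem deformationSub_units (hι : Function.Injective ι) :
    (deformationSub hι).units = univ ×ˢ range ι := by
  ext ⟨t, y⟩
  have h0 : (t • fun i : Fin n => (((0 : Fin n → ℤ) i : ℤ) : ℝ)) +ᵥ y = y :=
    congrArg Prod.snd (integerAct_zero (t, y))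
  refine ⟨fun ⟨q, _, hq, _⟩ => ⟨mem_univ _, q, hq⟩, ?_⟩
  rintro ⟨-, q, hq⟩
  exact ⟨q, q, hq, hq.trans h0.symm, fun s _ => dualityBracket_zero s,
    fun s _ => dualityBracket_zero s, rfl⟩

theorem source_image_deformationSlice (k : Fin n → ℤ) :
    (crossedGroupoid n N).source '' deformationSlice ι k =
      {p : ℝ × N | ∃ q ∈ orbitsKilledBy M k, ∃ q' ∈ orbitsKilledBy M k,
        ι q = p.2 ∧ ι q' = (p.1 • fun i => (k i : ℝ)) +ᵥ p.2 ∧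
        orbitIsotropy q = orbitIsotropy q'} := by
  ext ⟨t, y⟩
  constructor
  · rintro ⟨⟨t', y', k'⟩, ⟨⟨q, q', h1, h2, h3, h4, h5⟩, -, -, hk⟩, e⟩
    obtain ⟨rfl, rfl⟩ := Prod.ext_iff.1 e
    obtain rfl : k' = k := hk
    exact ⟨q, h3, q', h4, h1, h2, h5⟩
  · rintro ⟨q, h3, q', h4, h1, h2, h5⟩
    exact ⟨(t, y, k), ⟨⟨q, q', h1, h2, h3, h4, h5⟩, mem_univ _, mem_univ _, rfl⟩, rfl⟩

theorem range_image_deformationSlice (k : Fin n → ℤ) :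
    (crossedGroupoid n N).range '' deformationSlice ι k =
      (crossedGroupoid n N).source '' deformationSlice ι (-k) := by
  ext p
  constructor
  · rintro ⟨g, ⟨hg, -, -, hk⟩, rfl⟩
    refine ⟨_, ⟨deformationSet_inv_mem g hg, mem_univ _, mem_univ _, ?_⟩,
      (crossedGroupoid n N).source_inv g⟩
    exact congrArg Neg.neg (show g.2.2 = k from hk)
  · rintro ⟨g, ⟨hg, -, -, hk⟩, rfl⟩
    refine ⟨_, ⟨deformationSet_inv_mem g hg, mem_univ _, mem_univ _, ?_⟩,
      (crossedGroupoid n N).range_inv g⟩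
    exact neg_eq_iff_eq_neg.2 (show g.2.2 = -k from hk)

/-! ### Topology of the subgroupoid and its grading by `ℤⁿ`. -/

variable [TopologicalSpace N]

/-- Openness in a product with a discrete factor is checked slice by slice; the sign change between
range and source slices is harmless since `k` runs over all of `ℤⁿ`. -/
theorem isOpen_range_deformationSub_iff (hι : Function.Injective ι) {S : Set (ℝ × N)}
    (hS : (deformationSub hι).units = S) :
    IsOpen (range fun g : (deformationSub hι).carrier =>
      ((deformationSub hι).toGroupoid.range g, g.1.2.2)) ↔
      ∀ k : Fin n → ℤ, IsOpen
        {p : S | (p : ℝ × N) ∈ (crossedGroupoid n N).source '' deformationSlice ι k} := by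
  subst hS
  have h1 : ∀ k, {p : (deformationSub hι).units |
      (p : ℝ × N) ∈ (crossedGroupoid n N).source '' deformationSlice ι (-k)} =
      (fun p => (p, k)) ⁻¹' range fun g : (deformationSub hι).carrier =>
        ((deformationSub hι).toGroupoid.range g, g.1.2.2) := by
    intro k
    ext p
    rw [← range_image_deformationSlice]
    constructor
    · rintro ⟨g, ⟨hg, -, -, hk⟩, e⟩
      exact ⟨⟨g, hg⟩, Prod.ext (Subtype.ext e) hk⟩
    · rintro ⟨g, hg⟩
      obtain ⟨e, hk⟩ := Prod.ext_iff.1 hg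
      exact ⟨g, ⟨g.2, mem_univ _, mem_univ _, hk⟩, congrArg Subtype.val e⟩
  constructor
  · intro h k
    have := h1 (-k)
    rw [neg_neg] at this
    rw [this]
    exact h.preimage (by fun_prop)
  · intro h
    rw [isOpen_iff_continuous_mem, continuous_prod_of_discrete_right]
    intro k
    have := h (-k)
    rw [h1 k, isOpen_iff_continuous_mem] at this
    exact this

variable [ContinuousVAdd (Fin n → ℝ) N]

theorem crossedGroupoid_isTopological : (crossedGroupoid n N).IsTopological where
  continuous_source := by
    change Continuous fun g : ℝ × N × (Fin n → ℤ) => (g.1, g.2.1)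
    fun_prop
  continuous_range := by
    change Continuous fun g : ℝ × N × (Fin n → ℤ) => integerAct (g.1, g.2.1) g.2.2
    exact continuous_integerAct.comp
      (by fun_prop : Continuous fun g : ℝ × N × (Fin n → ℤ) => ((g.1, g.2.1), g.2.2))
  continuous_unit := by
    change Continuous fun p : ℝ × N => (p.1, p.2, (0 : Fin n → ℤ))
    fun_prop
  continuous_inv := by
    change Continuous fun g : ℝ × N × (Fin n → ℤ) =>
      (g.1, (integerAct (g.1, g.2.1) g.2.2).2, -g.2.2)
    have := continuous_integerAct.comp
      (by fun_prop : Continuous fun g : ℝ × N × (Fin n → ℤ) => ((g.1, g.2.1), g.2.2))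
    exact continuous_fst.prodMk ((continuous_snd.comp this).prodMk (by fun_prop))
  continuous_mul := by
    change Continuous fun p : {p : (ℝ × N × (Fin n → ℤ)) × (ℝ × N × (Fin n → ℤ)) //
      (crossedGroupoid n N).source p.1 = (crossedGroupoid n N).range p.2} =>
        (p.1.2.1, p.1.2.2.1, p.1.1.2.2 + p.1.2.2.2)
    fun_prop

theorem deformationSub_isGradedBy (hι : Function.Injective ι) :
    (deformationSub hι).toGroupoid.IsGradedBy fun g => g.1.2.2 where
  isTopological :=
    { continuous_source := (crossedGroupoid_isTopological.continuous_source.comp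
        continuous_subtype_val).subtype_mk _
      continuous_range := (crossedGroupoid_isTopological.continuous_range.comp
        continuous_subtype_val).subtype_mk _
      continuous_unit := (crossedGroupoid_isTopological.continuous_unit.comp
        continuous_subtype_val).subtype_mk _
      continuous_inv := (crossedGroupoid_isTopological.continuous_inv.comp
        continuous_subtype_val).subtype_mk _
      continuous_mul := by
        refine Continuous.subtype_mk (crossedGroupoid_isTopological.continuous_mul.comp
          (f := fun p : {p : (deformationSub hι).carrier × (deformationSub hι).carrier //
              (deformationSub hι).toGroupoid.source p.1 =
                (deformationSub hι).toGroupoid.range p.2} =>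
            ⟨(p.1.1.1, p.1.2.1), congrArg Subtype.val p.2⟩) ?_) _
        exact Continuous.subtype_mk (by fun_prop) _ }
  map_mul _ _ _ := rfl
  isEmbedding := by
    have hr : Continuous (deformationSub hι).toGroupoid.range :=
      (crossedGroupoid_isTopological.continuous_range.comp continuous_subtype_val).subtype_mk _
    have hf : Continuous fun p : (deformationSub hι).units × (Fin n → ℤ) =>
        ((p.1.1.1, (integerAct p.1.1 (-p.2)).2, p.2) : ℝ × N × (Fin n → ℤ)) := by
      have := (continuous_integerAct (n := n) (N := N)).comp
        (by fun_prop : Continuous fun p : (deformationSub hι).units × (Fin n → ℤ) =>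
          (p.1.1, -p.2))
      exact Continuous.prodMk (by fun_prop) ((continuous_snd.comp this).prodMk continuous_snd)
    -- Acting by `-k` on the range recovers the source, so composing with `hf` gives back the
    -- inclusion of arrows.
    refine IsEmbedding.of_comp (hr.prodMk (by fun_prop)) hf ?_
    convert IsEmbedding.subtypeVal (p := (· ∈ (deformationSub hι).carrier)) using 1
    funext g
    exact Prod.ext rfl (Prod.ext
      (congrArg Prod.snd (integerAct_neg (g.1.1, g.1.2.1) g.1.2.2)) rfl)

end DeformationGroupoid

theorem isOpenMap_fst_of_eq_univ_prod {A B : Type*} [TopologicalSpace A] [TopologicalSpace B]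
    {S : Set (A × B)} {T : Set B} (h : S = univ ×ˢ T) : IsOpenMap fun p : S => (p : A × B).1 := by
  subst h
  exact (isOpen_univ.isOpenEmbedding_subtypeVal.isOpenMap.comp isOpenMap_fst).comp
    (Homeomorph.Set.prod univ T).isOpenMap

theorem mainTheorem5 {n d d' : ℕ}
    {M : Type*} [TopologicalSpace M] [T2Space M] [SecondCountableTopology M] [Nonempty M]
    [ChartedSpace (EuclideanSpace ℝ (Fin d)) M] [IsManifold (𝓡 d) ∞ M]
    [MulAction (Torus n) M] [ContinuousSMul (Torus n) M]
    {N : Type*} [TopologicalSpace N] [T2Space N]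
    [ChartedSpace (EuclideanSpace ℝ (Fin d')) N] [IsManifold (𝓡 d') ∞ N]
    [AddAction (Fin n → ℝ) N] [ContinuousVAdd (Fin n → ℝ) N]
    (hβ : ∀ v : Fin n → ℝ, ContMDiff (𝓡 d') (𝓡 d') ∞ fun y : N => v +ᵥ y)
    (ι : MulAction.orbitRel.Quotient (Torus n) M → N)
    (hι : IsEmbedding ι) (hΔ : IsLocallyClosed (range ι)) :
    ∃ H : (crossedGroupoid n N).Sub,
      H.carrier = deformationSet ι ∧
      H.units = univ ×ˢ range ι ∧
      (∀ k : Fin n → ℤ, (crossedGroupoid n N).source '' deformationSlice ι k =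
        {p : ℝ × N | ∃ q ∈ orbitsKilledBy M k, ∃ q' ∈ orbitsKilledBy M k,
          ι q = p.2 ∧ ι q' = (p.1 • fun i => (k i : ℝ)) +ᵥ p.2 ∧
          orbitIsotropy q = orbitIsotropy q'}) ∧
      (H.toGroupoid.IsEtale ↔ ∀ k : Fin n → ℤ, IsOpen
        {p : (univ ×ˢ range ι : Set (ℝ × N)) |
          (p : ℝ × N) ∈ (crossedGroupoid n N).source '' deformationSlice ι k}) ∧
      (H.toGroupoid.IsEtale →
        H.toGroupoid.IsLocallyCompactHausdorffSeparable ∧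
        H.toGroupoid.IsAmenable ∧
        (∃ m, H.toGroupoid.IsContinuousHaarSystem m) ∧
        H.toGroupoid.IsBundle (fun g => (g : ℝ × N × (Fin n → ℤ)).1) ∧
        IsOpenMap (fun g : H.carrier => (g : ℝ × N × (Fin n → ℤ)).1) ∧
        Function.Surjective (fun g : H.carrier => (g : ℝ × N × (Fin n → ℤ)).1)) := by
  have hu := deformationSub_units hι.injective
  have hc := deformationSub_isGradedBy hι.injective
  have hopen := isOpen_range_deformationSub_iff hι.injective hu
  refine ⟨deformationSub hι.injective, rfl, hu, source_image_deformationSlice, ?_, fun h => ?_⟩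
  · rw [← hopen]
    refine ⟨hc.isOpen_range_of_isEtale, fun ho => ?_⟩
    have : LocallyCompactSpace N :=
      ChartedSpace.locallyCompactSpace (EuclideanSpace ℝ (Fin d')) N
    have : LocallyCompactSpace (range ι) := hΔ.locallyCompactSpace
    have : SecondCountableTopology (MulAction.orbitRel.Quotient (Torus n) M) :=
      ContinuousConstSMul.secondCountableTopology
    have : SecondCountableTopology (range ι) :=
      hι.toHomeomorph.symm.isEmbedding.secondCountableTopology
    let Φ : (deformationSub hι.injective).units ≃ₜ ↥(univ : Set ℝ) × range ι :=
      (Homeomorph.setCongr hu).trans (Homeomorph.Set.prod univ (range ι))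
    have : LocallyCompactSpace (univ : Set ℝ) := isOpen_univ.locallyCompactSpace
    have : LocallyCompactSpace (deformationSub hι.injective).units :=
      Φ.isOpenEmbedding.locallyCompactSpace
    have : SecondCountableTopology (deformationSub hι.injective).units :=
      Φ.isEmbedding.secondCountableTopology
    exact hc.isEtale ho
  · have ho := hc.isOpen_range_of_isEtale h
    have := h.locallyCompact
    have := h.hausdorff
    refine ⟨h.toIsLocallyCompactHausdorffSeparable, hc.isAmenable ho, ⟨_, h.haar_count⟩,
      ⟨by fun_prop, fun _ => rfl, fun _ => rfl⟩, ?_, fun t => ?_⟩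
    · exact ((isOpenMap_fst_of_eq_univ_prod hu).comp isOpenMap_fst).comp
        (IsOpenEmbedding.isOpenMap ⟨hc.isEmbedding, ho⟩)
    · obtain ⟨x⟩ := ‹Nonempty M›
      have hx : (t, ι (Quotient.mk'' x)) ∈ (deformationSub hι.injective).units :=
        hu ▸ ⟨mem_univ _, mem_range_self _⟩
      exact ⟨⟨_, hx⟩, rfl⟩
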